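/- Consider synchronous anonymous quantum networks. The underlying graph $G=(V,E)$ is a finite connected simple undirected graph with $n$ nodes (parties) and $m$ edges (bidirectional quantum links); each party $v$ of degree $d_v$ has ports labelled $1,\dots,d_v$, in bijection with its incident edges, the labellings at different parties being arbitrary and unrelated. All parties run the same algorithm: the initial local state of a party and its local operators (arbitrary physically realizable operators on its local memory and the messages at its ports) depend only on its number of ports, on the round number, and on the information given to all parties. There is no prior shared entanglement. In one round every party applies its local operator to its memory and the messages it has received, and then sends a (possibly empty) message of bits and qubits through each port. The bit complexity is the total number of bits and qubits communicated over all links in all rounds. An algorithm exactly solves the leader election problem if every party $i$ has a variable $y_i$, initialized to $1$, and after a bounded number of rounds, with certainty, $y_k=1$ for exactly one party $k$ and $y_i=0$ for all other parties. There are an absolute constant $C$ and an algorithm that receives as its only global information an integer $N$ and has the following property. For all integers $1\le n\le N$, every connected simple graph $G$ with $n$ nodes and $m$ edges, and every port numbering of $G$, the algorithm, with the upper bound $N$ of $n$ given to every party, exactly solves the leader election problem on the anonymous quantum network with underlying graph $G$ in at most $C\,N$ rounds with bit complexity at most $C\,m\,N^3$. -/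

import Mathlib

open scoped Matrix

namespace AnonQNet

/-- Messages: bit strings of length at most `B`, stored as their length together with their bits.
They label the computational basis of the register that a port carries in one round. The empty
string means that nothing is sent. -/
abbrev Word (B : ℕ) : Type := Σ k : Fin (B + 1), (Fin (k : ℕ) → Bool)

instance (B : ℕ) : Fintype (Word B) := Sigma.instFintype

instance (B : ℕ) : DecidableEq (Word B) := Sigma.instDecidableEqSigma

/-- The number of bits of a message. -/
def Word.length {B : ℕ} (w : Word B) : ℕ := (w.1 : ℕ)

/-- The empty message. -/
def Word.empty (B : ℕ) : Word B := ⟨0, fun _ => false⟩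

/-- A physically realizable operator (completely positive trace-preserving map) on the
finite-dimensional Hilbert space `ℂ^α`, given by Kraus operators. It sends a density matrix `ρ` to
`∑ i, K i * ρ * (K i)ᴴ`. Unitary operators and measurements are special cases. -/
structure Channel (α : Type) [Fintype α] [DecidableEq α] where
  ι : Type
  fintypeIndex : Fintype ι
  kraus : ι → Matrix α α ℂ
  complete : ∑ i, (kraus i)ᴴ * kraus i = 1

attribute [instance] Channel.fintypeIndex

/-- A (synchronous) quantum algorithm for anonymous networks. All parties run the same algorithm;
what a party does depends on nothing but the number `d` of its ports (and, the network being
synchronous, the number of the current round). Information shared by all parties is an argument of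
the algorithm, so that an algorithm to which a number `N` is given is a function
`ℕ → Algorithm`. -/
structure Algorithm where
  /-- computational basis of the local memory of a party with `d` ports -/
  State : ℕ → Type
  fintypeState : ∀ d, Fintype (State d)
  decEqState : ∀ d, DecidableEq (State d)
  /-- an arbitrary bound on the length of a single message -/
  maxLength : ℕ
  /-- initial local state -/
  init : ∀ d, State d
  /-- The local operator of round `r = 0, 1, 2, …`. It acts on the local memory and the messages at
  the `d` ports: it takes in the messages that have arrived, changes the local memory, and leaves
  at the ports the messages to be sent. -/
  step : ∀ d : ℕ, ℕ → Channel (State d × (Fin d → Word maxLength))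
  /-- the output variable, a classical variable contained in the local memory -/
  output : ∀ d, State d → Bool
  /-- the number of rounds after which every party halts -/
  rounds : ℕ

attribute [instance] Algorithm.fintypeState Algorithm.decEqState

/-- A port numbering: at every node `v`, a bijection between the labels of the ports of `v` and the
edges at `v`, that is, the neighbours of `v`. The numberings at different nodes are unrelated. -/
abbrev PortNumbering {V : Type} [Fintype V] (G : SimpleGraph V) [DecidableRel G.Adj] : Type :=
  ∀ v : V, Fin (G.degree v) ≃ G.neighborSet v

section Network

variable {V : Type} [Fintype V] {G : SimpleGraph V} [DecidableRel G.Adj]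

/-- The port at the other end of the link of a port. -/
def otherEnd (σ : PortNumbering G) (x : Σ v : V, Fin (G.degree v)) : Σ v : V, Fin (G.degree v) :=
  ⟨(σ x.1 x.2 : V), (σ (σ x.1 x.2 : V)).symm ⟨x.1, (σ x.1 x.2).2.symm⟩⟩

theorem otherEnd_otherEnd (σ : PortNumbering G) (x : Σ v : V, Fin (G.degree v)) :
    otherEnd σ (otherEnd σ x) = x := by
  have key : ∀ (v u : V) (h : G.Adj v u) (w : G.neighborSet u), w = ⟨v, h.symm⟩ →
      (⟨(w : V), (σ (w : V)).symm ⟨u, w.2.symm⟩⟩ : Σ v : V, Fin (G.degree v)) =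
        ⟨v, (σ v).symm ⟨u, h⟩⟩ := by
    rintro v u h w rfl
    rfl
  obtain ⟨v, p⟩ := x
  have h := key v (σ v p : V) (σ v p).2
    (σ (σ v p : V) ((σ (σ v p : V)).symm ⟨v, (σ v p).2.symm⟩)) (by simp)
  have h' : (σ v).symm ⟨(σ v p : V), (σ v p).2⟩ = p := by simp
  rw [h'] at h
  exact h

end Network

namespace Algorithm

variable {V : Type} [Fintype V] (A : Algorithm) (G : SimpleGraph V)
  [DecidableRel G.Adj]

/-- Computational basis of a party with `d` ports: local memory and the messages at its ports. -/
abbrev Local (d : ℕ) : Type := A.State d × (Fin d → Word A.maxLength)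

instance (d : ℕ) : Fintype (A.Local d) := instFintypeProd _ _

instance (d : ℕ) : DecidableEq (A.Local d) := instDecidableEqProd

/-- Computational basis of the whole network. -/
abbrev Config : Type := ∀ v : V, A.Local (G.degree v)

/-- Initial configuration: every party is in its initial state and there are no messages. -/
def initConfig : A.Config G := fun v => (A.init (G.degree v), fun _ => Word.empty A.maxLength)

variable {G}

/-- Transmission: the messages at the two ends of each link are exchanged. -/
def exchange (σ : PortNumbering G) (c : A.Config G) : A.Config G := fun v =>
  ((c v).1, fun p => (c (otherEnd σ ⟨v, p⟩).1).2 (otherEnd σ ⟨v, p⟩).2)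

theorem exchange_involutive (σ : PortNumbering G) :
    Function.Involutive (A.exchange σ : A.Config G → A.Config G) := by
  intro c
  funext v
  refine Prod.ext rfl (funext fun p => ?_)
  change (fun x : Σ v : V, Fin (G.degree v) => (c x.1).2 x.2) (otherEnd σ (otherEnd σ ⟨v, p⟩)) = _
  rw [otherEnd_otherEnd]

variable [DecidableEq V]

instance : Fintype (A.Config G) := Pi.instFintype

instance : DecidableEq (A.Config G) := Fintype.decidablePiFintype

/-- The tensor product, over all parties, of the Kraus operators of round `r` selected by `κ`. -/
def globalKraus (r : ℕ) (κ : ∀ v : V, (A.step (G.degree v) r).ι) :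
    Matrix (A.Config G) (A.Config G) ℂ :=
  Matrix.of fun c c' => ∏ v, (A.step (G.degree v) r).kraus (κ v) (c v) (c' v)

/-- The density matrix of the network after `r` rounds. In each round every party applies its local
operator, and then the messages are transmitted. -/
noncomputable def density (σ : PortNumbering G) : ℕ → Matrix (A.Config G) (A.Config G) ℂ
  | 0 => Matrix.single (A.initConfig G) (A.initConfig G) 1
  | r + 1 =>
      Matrix.reindex (A.exchange_involutive σ).toPerm (A.exchange_involutive σ).toPerm
        (∑ κ : (∀ v : V, (A.step (G.degree v) r).ι),
          A.globalKraus r κ * density σ r * (A.globalKraus r κ)ᴴ)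

/-- Exactly one party has the value `1` in its output variable. -/
def UniqueLeader (c : A.Config G) : Prop := ∃! v : V, A.output (G.degree v) (c v).1 = true

open Classical in
/-- The probability that exactly one party has the value `1` in its output variable when the
algorithm halts. -/
noncomputable def successProb (σ : PortNumbering G) : ℝ :=
  ∑ c : A.Config G with A.UniqueLeader c, (A.density σ A.rounds c c).re

/-- The algorithm exactly solves the leader election problem: all output variables are `1` at the
beginning, and with certainty exactly one of them is `1` at the end. -/
def ExactlyElectsLeader (σ : PortNumbering G) : Prop :=
  (∀ v : V, A.output (G.degree v) (A.init (G.degree v)) = true) ∧ A.successProb σ = 1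

open Classical in
/-- The number of bits and qubits received in round `r` through port `p` of party `v`: the length
of the longest message that occurs there with nonzero probability. -/
noncomputable def portBits (σ : PortNumbering G) (r : ℕ) (v : V) (p : Fin (G.degree v)) : ℕ :=
  ({c : A.Config G | A.density σ (r + 1) c c ≠ 0} : Finset (A.Config G)).sup
    fun c => ((c v).2 p).length

/-- Bit complexity: the number of bits and qubits communicated over all links, in both directions
and in all rounds. -/
noncomputable def bitComplexity (σ : PortNumbering G) : ℕ :=
  ∑ r ∈ Finset.range A.rounds, ∑ v : V, ∑ p : Fin (G.degree v), A.portBits σ r v p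

end Algorithm

end AnonQNet

/-! The algorithm is exact amplitude amplification, run in parallel for every guess `k + 1` of the
number `n` of parties. For each `k` every party holds one bit, rotated so that, if `n = k + 1`,
exactly one of the `n` bits is set with probability `1 / 4` (`exists_rotation_amplitudes`). From
this probability one iteration is exact: if `φ₁` is the prepared state and `φ₂` arises from it by
flipping the sign of the part of weight one, then `⟨φ₁, φ₂⟩ = 1 / 2`, and the reflection `1 -
2|φ₁⟩⟨φ₁|` maps `φ₂` to `φ₂ - φ₁`, which vanishes off weight one (`amplification_eq_zero`).
Different guesses never interact, so the state is a product over `k`, and the factor of the right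
guess forces a unique set bit, whatever the other factors do (`networkState_final`).

The sign flips require knowledge of the weights. To obtain the proportions of set bits, the parties
iterate `y ↦ (N - L) y`, with `L` the Laplacian, on integers that pack their bits in base `4 ^ N`. A
polynomial `g` of degree at most `N` annihilates the iteration on vectors of sum zero, and `g(N) ≠
0` by connectedness. Hence `2N + 1` successive values at a single party determine the mean, although
the party knows neither the graph nor `g` (`isMean_averaging`, `IsMean.unique`); the mean determines
all proportions (`IsRatios.unique`). Each party then contributes the phase `exp(iπ / (k + 1))`, and
`n = k + 1` of these multiply to `-1`. Recording all messages makes the averaging reversible, and it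
is undone after each phase so that the bits are again disentangled from the records.

A last averaging, not undone, reveals the right guess: its proportion `1 / n` is the least possible
nonzero one (`wins_iff`). All values sent are below `2 ^ (4N²)` and there are `10N + 6` rounds,
whence the complexity bounds. -/

namespace AnonQNet

/-! ### Tensor products and monomial unitaries -/

/-- The channel given by a single unitary matrix. -/
def unitaryChannel {α : Type} [Fintype α] [DecidableEq α] (U : Matrix α α ℂ) (h : Uᴴ * U = 1) :
    Channel α where
  ι := Unit
  fintypeIndex := inferInstance
  kraus := fun _ => U
  complete := by simpa using h

/-- The tensor product of a family of square matrices. -/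
def tensorMatrix {ι : Type*} [Fintype ι] {α : ι → Type*} (M : ∀ i, Matrix (α i) (α i) ℂ) :
    Matrix (∀ i, α i) (∀ i, α i) ℂ :=
  Matrix.of fun a b => ∏ i, M i (a i) (b i)

theorem tensorMatrix_unitary {ι : Type*} [Fintype ι] [DecidableEq ι] {α : ι → Type*}
    [∀ i, Fintype (α i)] [∀ i, DecidableEq (α i)] (M : ∀ i, Matrix (α i) (α i) ℂ)
    (h : ∀ i, (M i)ᴴ * M i = 1) : (tensorMatrix M)ᴴ * tensorMatrix M = 1 := by
  ext a b
  have key : ∀ i, ∑ x, star (M i x (a i)) * M i x (b i) = if a i = b i then 1 else 0 := by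
    intro i
    have := congrFun (congrFun (h i) (a i)) (b i)
    simpa [Matrix.mul_apply, Matrix.one_apply] using this
  have expand := Finset.prod_univ_sum (fun i => (Finset.univ : Finset (α i)))
    (fun i x => star (M i x (a i)) * M i x (b i))
  rw [Fintype.piFinset_univ] at expand
  simp only [Matrix.mul_apply, Matrix.conjTranspose_apply, tensorMatrix, Matrix.of_apply,
    star_prod, ← Finset.prod_mul_distrib]
  rw [← expand]
  simp only [key, Matrix.one_apply]
  rw [Finset.prod_ite_zero]
  simp [funext_iff]

/-- The matrix that sends the basis vector `b` to `θ b` times the basis vector `π b`. -/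
def monomialMatrix {α : Type*} [DecidableEq α] (π : α → α) (θ : α → ℂ) : Matrix α α ℂ :=
  Matrix.of fun a b => if a = π b then θ b else 0

theorem monomialMatrix_unitary {α : Type*} [Fintype α] [DecidableEq α] {π : α → α}
    (hπ : Function.Injective π) {θ : α → ℂ} (hθ : ∀ b, star (θ b) * θ b = 1) :
    (monomialMatrix π θ)ᴴ * monomialMatrix π θ = 1 := by
  ext a b
  simp only [Matrix.mul_apply, Matrix.conjTranspose_apply, monomialMatrix, Matrix.of_apply,
    Matrix.one_apply]
  rw [Finset.sum_eq_single (π b)]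
  · by_cases hab : a = b
    · subst hab
      simpa using hθ a
    · have hne : π b ≠ π a := fun h => hab (hπ h).symm
      simp [hab, hne]
  · intro x _ hx
    simp [hx]
  · simp

/-! ### State vectors of networks with unitary operators -/

namespace Algorithm

variable {V : Type} [Fintype V] [DecidableEq V] {A : Algorithm} {G : SimpleGraph V}
  [DecidableRel G.Adj]

/-- All local operators of the algorithm are given by the unitary matrices `U`. -/
def IsUnitary (A : Algorithm) (U : ∀ d, ℕ → Matrix (A.Local d) (A.Local d) ℂ) : Prop :=
  ∀ d r, ∃ h, A.step d r = unitaryChannel (U d r) h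

/-- The state vector of the network after `r` rounds of an algorithm with unitary operators. -/
noncomputable def amplitude (U : ∀ d, ℕ → Matrix (A.Local d) (A.Local d) ℂ) (σ : PortNumbering G) :
    ℕ → A.Config G → ℂ
  | 0 => Pi.single (A.initConfig G) 1
  | r + 1 => fun c => ∑ c' : A.Config G,
      (∏ v, U (G.degree v) r (A.exchange σ c v) (c' v)) * amplitude U σ r c'

variable {U : ∀ d, ℕ → Matrix (A.Local d) (A.Local d) ℂ}

/-- Each party has a single Kraus operator, so the sum has one term. The argument `F` serves
expressions in which the operator occurs twice, such as `K * ρ * Kᴴ`. -/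
theorem sum_globalKraus (hU : A.IsUnitary U) (r : ℕ) (F : Matrix (A.Config G) (A.Config G) ℂ →
      Matrix (A.Config G) (A.Config G) ℂ) :
    ∑ κ : (∀ v : V, (A.step (G.degree v) r).ι), F (A.globalKraus r κ) =
      F (tensorMatrix fun v => U (G.degree v) r) := by
  choose h hs using fun d => hU d r
  have h1 : ∀ d, ∃ k : (A.step d r).ι, ∀ k', k' = k := by
    intro d
    rw [hs d]
    exact ⟨(), fun _ => rfl⟩
  have h2 : ∀ d (k : (A.step d r).ι), (A.step d r).kraus k = U d r := by
    intro d
    rw [hs d]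
    exact fun _ => rfl
  choose k0 hk0 using h1
  rw [Fintype.sum_eq_single (fun v => k0 (G.degree v))]
  · congr 1
    ext c c'
    simp [globalKraus, tensorMatrix, h2]
  · intro κ hκ
    exact absurd (funext fun v => hk0 _ (κ v)) hκ

theorem density_eq_amplitude (hU : A.IsUnitary U) (σ : PortNumbering G) (r : ℕ) :
    A.density σ r = Matrix.of fun c c' => amplitude U σ r c * star (amplitude U σ r c') := by
  induction r with
  | zero =>
    ext c c'
    simp only [density, amplitude, Matrix.single_apply, Matrix.of_apply, Pi.single_apply]
    by_cases h1 : c = A.initConfig G <;> by_cases h2 : c' = A.initConfig G <;>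
      simp [h1, h2, eq_comm]
  | succ r ih =>
    rw [density, sum_globalKraus hU r (fun K => K * A.density σ r * Kᴴ), ih]
    ext c c'
    have hs : ∀ c : A.Config G, (A.exchange_involutive σ).toPerm.symm c = A.exchange σ c :=
      fun c => rfl
    simp only [Matrix.reindex_apply, Matrix.submatrix_apply, hs, Matrix.mul_apply, Matrix.of_apply,
      Matrix.conjTranspose_apply, amplitude, tensorMatrix]
    rw [star_sum, Finset.sum_mul_sum, Finset.sum_comm]
    simp only [Finset.sum_mul, star_mul']
    refine Finset.sum_congr rfl fun x _ => Finset.sum_congr rfl fun y _ => ?_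
    ring

theorem amplitude_norm (hU : A.IsUnitary U) (σ : PortNumbering G) (r : ℕ) :
    ∑ c, star (amplitude U σ r c) * amplitude U σ r c = 1 := by
  induction r with
  | zero => simp [amplitude, Pi.single_apply]
  | succ r ih =>
    have hun := tensorMatrix_unitary (fun v => U (G.degree v) r)
      (fun v => (hU (G.degree v) r).choose)
    have h1 : amplitude U σ (r + 1) = fun c =>
        ((tensorMatrix fun v => U (G.degree v) r) *ᵥ amplitude U σ r) (A.exchange σ c) := rfl
    rw [h1]
    have h2 := Equiv.sum_comp (A.exchange_involutive σ).toPerm (fun c =>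
      star (((tensorMatrix fun v => U (G.degree v) r) *ᵥ amplitude U σ r) c) *
        ((tensorMatrix fun v => U (G.degree v) r) *ᵥ amplitude U σ r) c)
    refine h2.trans ?_
    change star (_ *ᵥ _) ⬝ᵥ (_ *ᵥ _) = 1
    rw [Matrix.star_mulVec, ← Matrix.dotProduct_mulVec, Matrix.mulVec_mulVec, hun,
      Matrix.one_mulVec]
    exact ih

theorem successProb_eq_one (hU : A.IsUnitary U) (σ : PortNumbering G)
    (h : ∀ c, amplitude U σ A.rounds c ≠ 0 → A.UniqueLeader c) : A.successProb σ = 1 := by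
  classical
  unfold successProb
  have h1 := congrArg Complex.re (amplitude_norm hU σ A.rounds)
  rw [Complex.re_sum, Complex.one_re] at h1
  rw [← h1, Finset.sum_filter]
  refine Finset.sum_congr rfl fun c _ => ?_
  rw [density_eq_amplitude hU, Matrix.of_apply, mul_comm]
  split_ifs with hc
  · rfl
  · have : amplitude U σ A.rounds c = 0 := by
      by_contra h0
      exact hc (h c h0)
    simp [this]

theorem Word.length_le {B : ℕ} (w : Word B) : w.length ≤ B := Nat.lt_succ_iff.mp w.1.2

theorem bitComplexity_le (A : Algorithm) (σ : PortNumbering G) :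
    A.bitComplexity σ ≤ A.rounds * (2 * G.edgeFinset.card * A.maxLength) := by
  unfold bitComplexity
  calc _ ≤ ∑ _r ∈ Finset.range A.rounds, ∑ v : V, ∑ _p : Fin (G.degree v), A.maxLength := by
        gcongr
        exact Finset.sup_le fun c _ => Word.length_le _
    _ = _ := by
        simp [← Finset.sum_mul, G.sum_degrees_eq_twice_card_edges]

/-- The state vector with amplitudes `Φ` on the configurations `e X`. -/
def encode {Ω : Type*} [Fintype Ω] (e : Ω → A.Config G) (Φ : Ω → ℂ) : A.Config G → ℂ :=
  fun c => ∑ X, if c = e X then Φ X else 0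

theorem amplitude_succ_encode {Ω : Type*} [Fintype Ω] {e : Ω → A.Config G} {Φ : Ω → ℂ}
    {σ : PortNumbering G} {r : ℕ} (h : amplitude U σ r = encode e Φ) (c : A.Config G) :
    amplitude U σ (r + 1) c =
      ∑ X, (∏ v, U (G.degree v) r (A.exchange σ c v) (e X v)) * Φ X := by
  simp only [amplitude, h, encode, Finset.mul_sum]
  rw [Finset.sum_comm]
  refine Finset.sum_congr rfl fun X _ => ?_
  simp

theorem amplitude_succ_monomial {Ω : Type*} [Fintype Ω] {e : Ω → A.Config G} {Φ : Ω → ℂ}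
    {σ : PortNumbering G} {r : ℕ} (h : amplitude U σ r = encode e Φ)
    (π : ∀ d, A.Local d → A.Local d) (θ : ∀ d, A.Local d → ℂ)
    (hr : ∀ d, U d r = monomialMatrix (π d) (θ d)) :
    amplitude U σ (r + 1) = encode (fun X => A.exchange σ fun v => π _ (e X v))
      (fun X => (∏ v, θ _ (e X v)) * Φ X) := by
  ext c
  rw [amplitude_succ_encode h]
  refine Finset.sum_congr rfl fun X _ => ?_
  simp only [hr, monomialMatrix, Matrix.of_apply]
  rw [Finset.prod_ite_zero]
  have : (c = A.exchange σ fun v => π _ (e X v)) ↔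
      ∀ v ∈ Finset.univ, A.exchange σ c v = π _ (e X v) := by
    rw [← (A.exchange_involutive σ).eq_iff, funext_iff]
    simp
  simp only [this]
  split_ifs <;> simp

/-- For operators that act only on a register `β`: the product of the local sums expands into the
tensor power of `R`, and by `hx` the transmission has no effect. -/
theorem amplitude_succ_product {β : Type} [Fintype β] {Φ : (V → β) → ℂ}
    {σ : PortNumbering G} {r : ℕ} (loc : ∀ d, β → A.Local d)
    (hx : ∀ X : V → β, A.exchange σ (fun v => loc (G.degree v) (X v)) = fun v => loc _ (X v))
    (h : amplitude U σ r = encode (fun X v => loc _ (X v)) Φ) (R : Matrix β β ℂ)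
    (hr : ∀ d a y, U d r a (loc d y) = ∑ x, if a = loc d x then R x y else 0) :
    amplitude U σ (r + 1) = encode (fun X v => loc _ (X v))
      (tensorMatrix (fun _ : V => R) *ᵥ Φ) := by
  ext c
  rw [amplitude_succ_encode h]
  simp only [encode, hr, tensorMatrix, Matrix.mulVec, dotProduct, Matrix.of_apply]
  have key : ∀ X : V → β, (∏ v, ∑ x, if A.exchange σ c v = loc (G.degree v) x then R x (X v) else 0)
      = ∑ Y : V → β, if c = (fun v => loc (G.degree v) (Y v)) then ∏ v, R (Y v) (X v) else 0 := by
    intro X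
    rw [Finset.prod_univ_sum, Fintype.piFinset_univ]
    refine Finset.sum_congr rfl fun Y _ => ?_
    rw [Finset.prod_ite_zero]
    have : (c = fun v => loc (G.degree v) (Y v)) ↔
        ∀ v ∈ Finset.univ, A.exchange σ c v = loc _ (Y v) := by
      rw [← hx Y, ← (A.exchange_involutive σ).eq_iff, funext_iff]
      simp
    simp only [this]
    congr
  simp only [key, Finset.sum_mul]
  rw [Finset.sum_comm]
  refine Finset.sum_congr rfl fun Y _ => ?_
  split_ifs <;> simp

end Algorithm

/-! ### Recovering the mean from the averaging sequence of one node -/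

open Polynomial

/-- `a` is the mean value that is encoded in the first `2 * N + 1` terms of the sequence `s`. -/
def IsMean (N : ℕ) (s : ℕ → ℕ) (a : ℚ) : Prop :=
  ∃ g : ℚ[X], g.natDegree ≤ N ∧ g.eval (N : ℚ) ≠ 0 ∧ ∀ q : ℚ[X], q.natDegree ≤ N →
    ∑ i ∈ Finset.range (2 * N + 1), (q * g).coeff i * (s i : ℚ) = (q * g).eval (N : ℚ) * a

/-- The freedom in `q` is essential: the two witnesses may come from different graphs, and taking
each as the `q` of the other evaluates the same sum, with coefficients of `g * g'`, in two ways. -/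
theorem IsMean.unique {N : ℕ} {s : ℕ → ℕ} {a b : ℚ} (ha : IsMean N s a) (hb : IsMean N s b) :
    a = b := by
  obtain ⟨g, hg, hg0, hga⟩ := ha
  obtain ⟨g', hg', hg0', hgb⟩ := hb
  have h1 := hga g' hg'
  have h2 := hgb g hg
  rw [mul_comm g g', h1, eval_mul] at h2
  exact mul_left_cancel₀ (mul_ne_zero hg0' hg0) h2

theorem aeval_restrict_apply {E : Type*} [AddCommGroup E] [Module ℚ E] (f : Module.End ℚ E)
    (W : Submodule ℚ E) (hf : ∀ x ∈ W, f x ∈ W) (g : ℚ[X]) (z : W) :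
    ((aeval (LinearMap.restrict f hf) g z : W) : E) = aeval f g (z : E) := by
  induction g using Polynomial.induction_on' with
  | add p q hp hq => simp [hp, hq]
  | monomial n a =>
    have : ∀ n : ℕ, (((LinearMap.restrict f hf ^ n) z : W) : E) = (f ^ n) (z : E) := by
      intro n
      induction n with
      | zero => simp
      | succ n ih => rw [pow_succ', pow_succ', Module.End.mul_apply, Module.End.mul_apply, ← ih]; rfl
    simp [aeval_monomial, this]

section Graph

variable {V : Type} [Fintype V] (G : SimpleGraph V) [DecidableRel G.Adj]

/-- One round of the averaging iteration `y ↦ (N - L) y`, where `L` is the Laplacian. -/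
def averagingStep (N : ℕ) (y : V → ℕ) (v : V) : ℕ :=
  (N - G.degree v) * y v + ∑ u ∈ G.neighborFinset v, y u

variable {G} in
theorem averagingStep_iterate_le {N : ℕ} (hN : ∀ v, G.degree v ≤ N) {y : V → ℕ} {b : ℕ}
    (hy : ∀ v, y v ≤ b) (t : ℕ) (v : V) : (averagingStep G N)^[t] y v ≤ N ^ t * b := by
  induction t generalizing v with
  | zero => simpa using hy v
  | succ t ih =>
    rw [Function.iterate_succ_apply', averagingStep]
    calc _ ≤ (N - G.degree v) * (N ^ t * b) + ∑ u ∈ G.neighborFinset v, N ^ t * b := by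
          gcongr with u hu
          · exact ih v
          · exact ih u
      _ = ((N - G.degree v) + G.degree v) * (N ^ t * b) := by
          rw [Finset.sum_const, G.card_neighborFinset_eq_degree, smul_eq_mul, add_mul]
      _ = N ^ (t + 1) * b := by rw [Nat.sub_add_cancel (hN v)]; ring

variable [DecidableEq V]

/-- The averaging iteration as a linear map. -/
noncomputable def averagingMap (N : ℕ) : Module.End ℚ (V → ℚ) :=
  (N : ℚ) • 1 - Matrix.toLin' (G.lapMatrix ℚ)

theorem averagingMap_apply (N : ℕ) (y : V → ℚ) (v : V) :
    averagingMap G N y v = N * y v - (G.degree v * y v - ∑ u ∈ G.neighborFinset v, y u) := by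
  simp [averagingMap, SimpleGraph.lapMatrix_mulVec_apply]

variable {G}

theorem averagingMap_pow_apply {N : ℕ} (hN : ∀ v, G.degree v ≤ N) (y : V → ℕ) (t : ℕ) :
    (averagingMap G N ^ t) (fun v => (y v : ℚ)) =
      fun v => (((averagingStep G N)^[t] y v : ℕ) : ℚ) := by
  induction t with
  | zero => simp
  | succ t ih =>
    rw [pow_succ', Module.End.mul_apply, ih]
    ext v
    rw [averagingMap_apply, Function.iterate_succ_apply', averagingStep]
    push_cast [hN v]
    ring

-- The constant vector is an eigenvector of `N - L` with eigenvalue `N`, and the vectors of sum zero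
-- form an invariant complement. The witness `g` is the characteristic polynomial on this
-- complement; by Cayley–Hamilton, `(q * g)(N - L)` sees only the mean.
omit [DecidableEq V] in
theorem isMean_averaging {N : ℕ} (hG : G.Connected) (hN : Fintype.card V ≤ N) (y : V → ℕ) (v : V) :
    IsMean N (fun t => (averagingStep G N)^[t] y v) ((∑ u, (y u : ℚ)) / Fintype.card V) := by
  classical
  have hdeg : ∀ v, G.degree v ≤ N := fun v => (G.degree_lt_card_verts v).le.trans hN
  have : Nonempty V := hG.nonempty
  have hn : (Fintype.card V : ℚ) ≠ 0 := by exact_mod_cast Fintype.card_ne_zero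
  set f := averagingMap G N with hf
  let S : (V → ℚ) →ₗ[ℚ] ℚ := ∑ u, LinearMap.proj u
  have hS : ∀ z, S z = ∑ u, z u := fun z => by simp [S]
  have hfS : ∀ z, S (f z) = N * S z := by
    intro z
    simp only [hS, hf, averagingMap_apply, Finset.sum_sub_distrib, ← Finset.mul_sum]
    have : ∑ v, ∑ u ∈ G.neighborFinset v, z u = ∑ v, (G.degree v : ℚ) * z v := by
      simp only [SimpleGraph.neighborFinset_eq_filter, Finset.sum_filter]
      rw [Finset.sum_comm]
      refine Finset.sum_congr rfl fun u _ => ?_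
      rw [← Finset.sum_filter, Finset.sum_const, nsmul_eq_mul, ← G.card_neighborFinset_eq_degree,
        SimpleGraph.neighborFinset_eq_filter]
      simp only [G.adj_comm]
    rw [this]
    ring
  have hW : ∀ z ∈ LinearMap.ker S, f z ∈ LinearMap.ker S := by
    intro z hz
    rw [LinearMap.mem_ker] at hz ⊢
    rw [hfS, hz, mul_zero]
  set fW := LinearMap.restrict f hW with hfW
  refine ⟨fW.charpoly, ?_, ?_, ?_⟩
  · rw [LinearMap.charpoly_natDegree]
    refine (Submodule.finrank_le _).trans ?_
    simpa using hN
  -- If `N` were a root, a nonzero vector of sum zero would lie in the kernel of the Laplacian. On a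
  -- connected graph it would be constant, hence zero.
  · intro h0
    have hev := (Module.End.hasEigenvalue_iff_isRoot_charpoly fW (N : ℚ)).2 h0
    obtain ⟨z, hz, hz0⟩ := hev.exists_hasEigenvector
    have hfz : f z.1 = (N : ℚ) • z.1 := by
      have := congrArg Subtype.val (Module.End.mem_eigenspace_iff.1 hz)
      simpa [hfW] using this
    have hL : G.lapMatrix ℚ *ᵥ z.1 = 0 := by
      have h1 : f z.1 = (N : ℚ) • z.1 - G.lapMatrix ℚ *ᵥ z.1 := by simp [hf, averagingMap]
      rw [hfz] at h1
      exact sub_eq_self.1 h1.symm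
    have hadj := (SimpleGraph.lapMatrix_toLinearMap₂'_apply'_eq_zero_iff_forall_adj ℚ G z.1).1
      (by rw [Matrix.toLinearMap₂'_apply', hL, dotProduct_zero])
    have hc : ∀ u w, z.1 u = z.1 w := by
      intro u w
      obtain ⟨p⟩ := hG.preconnected u w
      induction p with
      | nil => rfl
      | cons h _ ih => exact (hadj _ _ h).trans ih
    apply hz0
    have hzS : ∑ u, z.1 u = 0 := by
      rw [← hS]
      exact LinearMap.mem_ker.1 z.2
    ext w
    have : ∑ u, z.1 u = Fintype.card V * z.1 w := by
      rw [Finset.sum_congr rfl fun u _ => hc u w]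
      simp
    rw [hzS] at this
    simpa [hn] using this.symm
  · intro q hq
    set g := fW.charpoly with hg
    set a := (∑ u, (y u : ℚ)) / Fintype.card V with ha
    set Y : V → ℚ := fun u => (y u : ℚ) with hY
    have hz : Y - a • (1 : V → ℚ) ∈ LinearMap.ker S := by
      rw [LinearMap.mem_ker, hS]
      simp [hY, ha, Finset.sum_sub_distrib]
      field_simp
      ring
    have h1 : f 1 = (N : ℚ) • (1 : V → ℚ) := by
      ext u
      rw [hf, averagingMap_apply]
      simp
    have hone : ∀ p : ℚ[X], aeval f p (1 : V → ℚ) = p.eval (N : ℚ) • (1 : V → ℚ) := by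
      intro p
      exact Module.End.aeval_apply_of_hasEigenvector
        ⟨Module.End.mem_eigenspace_iff.2 h1, one_ne_zero⟩
    have hgz : aeval f g (Y - a • (1 : V → ℚ)) = 0 := by
      have := aeval_restrict_apply f _ hW g ⟨_, hz⟩
      rw [← this, hg, LinearMap.aeval_self_charpoly]
      rfl
    have hqg : aeval f (q * g) Y = ((q * g).eval (N : ℚ) * a) • (1 : V → ℚ) := by
      have : Y = (Y - a • (1 : V → ℚ)) + a • (1 : V → ℚ) := by simp
      rw [this, map_add, map_mul, Module.End.mul_apply, hgz, map_zero, zero_add, ← map_mul,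
        map_smul, hone, smul_smul, mul_comm]
    have hdegree : (q * g).natDegree < 2 * N + 1 := by
      have h2 : g.natDegree ≤ N := by
        rw [hg, LinearMap.charpoly_natDegree]
        refine (Submodule.finrank_le _).trans ?_
        simpa using hN
      have := natDegree_mul_le (p := q) (q := g)
      omega
    have hsum := congrFun hqg v
    rw [aeval_eq_sum_range' hdegree] at hsum
    simp only [LinearMap.sum_apply, LinearMap.smul_apply, hY, hf,
      averagingMap_pow_apply hdeg, Finset.sum_apply, Pi.smul_apply, Pi.one_apply,
      smul_eq_mul, mul_one] at hsum
    exact hsum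

end Graph

/-! ### Decoding all proportions from one mean -/

/-- Digits in base `B` of absolute value less than `B`, of a vanishing sum, vanish. -/
theorem digits_eq_zero {B : ℤ} (hB : 0 < B) : ∀ {n : ℕ} (c : Fin n → ℤ), (∀ i, |c i| < B) →
    ∑ i, c i * B ^ (i : ℕ) = 0 → ∀ i, c i = 0
  | 0, _, _, _, i => i.elim0
  | n + 1, c, hc, h, i => by
    rw [Fin.sum_univ_succ] at h
    simp only [Fin.val_zero, pow_zero, mul_one, Fin.val_succ, pow_succ, ← mul_assoc,
      ← Finset.sum_mul] at h
    have h0 : c 0 = 0 := by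
      refine Int.eq_zero_of_abs_lt_dvd (m := B) ⟨-∑ i : Fin n, c i.succ * B ^ (i : ℕ), ?_⟩ (hc 0)
      linarith
    rw [h0, zero_add] at h
    have h1 := digits_eq_zero hB (fun i => c i.succ) (fun i => hc _)
      ((mul_eq_zero.1 h).resolve_right hB.ne')
    exact Fin.cases h0 h1 i

/-- The bits of a party as a natural number, in base `4 ^ N`. -/
def packBits (N : ℕ) (x : Fin N → Bool) : ℕ := ∑ k, (x k).toNat * (4 ^ N) ^ (k : ℕ)

theorem packBits_lt (N : ℕ) (x : Fin N → Bool) : packBits N x < (4 ^ N) ^ N := by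
  have key : ∀ (B : ℕ), 2 ≤ B → ∀ (m : ℕ) (x : Fin m → Bool),
      ∑ k, (x k).toNat * B ^ (k : ℕ) < B ^ m := by
    intro B hB m
    induction m with
    | zero => simp
    | succ m ih =>
      intro x
      rw [Fin.sum_univ_castSucc, pow_succ]
      have h1 := ih (fun k => x k.castSucc)
      have h2 : (x (Fin.last m)).toNat * B ^ m ≤ 1 * B ^ m :=
        Nat.mul_le_mul_right _ (Bool.toNat_le _)
      simp only [Fin.val_castSucc, Fin.val_last] at *
      nlinarith [Nat.mul_le_mul_left (B ^ m) hB]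
  rcases Nat.eq_zero_or_pos N with rfl | hN
  · simp [packBits]
  · exact key _ ((by norm_num : 2 ≤ 4 ^ 1).trans (Nat.pow_le_pow_right (by norm_num) hN)) N x

/-- `w k` is the proportion of parties whose bit `k` is set, as encoded in the sequence `s`. -/
def IsRatios (N : ℕ) (s : ℕ → ℕ) (w : Fin N → ℚ) : Prop :=
  ∃ (n : ℕ) (c : Fin N → ℕ), 0 < n ∧ n ≤ N ∧ (∀ k, c k ≤ n) ∧ (∀ k, w k = c k / n) ∧
    IsMean N s ((∑ k : Fin N, (c k : ℚ) * ((4 ^ N) ^ (k : ℕ) : ℕ)) / n)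

/-- Cross-multiplying the two means gives a vanishing sum in base `4 ^ N` with digits `c k * n' - c'
k * n`, of absolute value at most `N ^ 2 < 4 ^ N`. Only the quotients `c k / n` are determined, not
`n` itself. -/
theorem IsRatios.unique {N : ℕ} {s : ℕ → ℕ} {w w' : Fin N → ℚ} (h : IsRatios N s w)
    (h' : IsRatios N s w') : w = w' := by
  obtain ⟨n, c, hn, hnN, hc, hw, hm⟩ := h
  obtain ⟨n', c', hn', hnN', hc', hw', hm'⟩ := h'
  have hq : (n : ℚ) ≠ 0 := by exact_mod_cast hn.ne'
  have hq' : (n' : ℚ) ≠ 0 := by exact_mod_cast hn'.ne'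
  have heq := hm.unique hm'
  rw [div_eq_div_iff hq hq'] at heq
  have hz : ∑ k : Fin N, ((c k : ℤ) * n' - c' k * n) * ((4 : ℤ) ^ N) ^ (k : ℕ) = 0 := by
    have : ∑ k : Fin N, ((c k : ℚ) * n' - c' k * n) * ((4 : ℚ) ^ N) ^ (k : ℕ) = 0 := by
      simp only [sub_mul, Finset.sum_sub_distrib]
      rw [sub_eq_zero]
      push_cast at heq
      rw [Finset.sum_mul, Finset.sum_mul] at heq
      convert heq using 2 <;> ring
    exact_mod_cast this
  have hB : (N : ℤ) * N < 4 ^ N := by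
    have h1 : N < 2 ^ N := Nat.lt_two_pow_self
    have h2 : N * N < 2 ^ N * 2 ^ N := by nlinarith
    rw [← mul_pow] at h2
    exact_mod_cast h2
  have hbound : ∀ k, |(c k : ℤ) * n' - c' k * n| < 4 ^ N := by
    intro k
    have h1 : (c k : ℤ) * n' ≤ N * N := by
      exact_mod_cast Nat.mul_le_mul ((hc k).trans hnN) hnN'
    have h2 : (c' k : ℤ) * n ≤ N * N := by
      exact_mod_cast Nat.mul_le_mul ((hc' k).trans hnN') hnN
    have h3 : (0 : ℤ) ≤ (c k : ℤ) * n' := by positivity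
    have h4 : (0 : ℤ) ≤ (c' k : ℤ) * n := by positivity
    rw [abs_lt]
    constructor <;> linarith
  have hall := digits_eq_zero (by positivity) _ hbound hz
  funext k
  rw [hw, hw', div_eq_div_iff hq hq']
  have := hall k
  rw [sub_eq_zero] at this
  exact_mod_cast this

open Classical in
/-- The proportions that are encoded in the sequence `s`. -/
noncomputable def ratios (N : ℕ) (s : ℕ → ℕ) : Fin N → ℚ :=
  if h : ∃ w, IsRatios N s w then h.choose else 0

theorem IsRatios.ratios_eq {N : ℕ} {s : ℕ → ℕ} {w : Fin N → ℚ} (h : IsRatios N s w) :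
    ratios N s = w := by
  have h' : ∃ w, IsRatios N s w := ⟨w, h⟩
  rw [ratios, dif_pos h']
  exact h'.choose_spec.unique h

theorem ratios_averaging {V : Type} [Fintype V] [DecidableEq V] {G : SimpleGraph V}
    [DecidableRel G.Adj] {N : ℕ} (hG : G.Connected) (hN : Fintype.card V ≤ N)
    (X : V → Fin N → Bool) (v : V) {s : ℕ → ℕ}
    (hs : ∀ t ≤ 2 * N, s t = (averagingStep G N)^[t] (fun u => packBits N (X u)) v) (k : Fin N) :
    ratios N s k = (∑ u, (X u k).toNat : ℕ) / Fintype.card V := by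
  have : Nonempty V := hG.nonempty
  have hmean := isMean_averaging hG hN (fun u => packBits N (X u)) v
  have h : IsRatios N s (fun k => (∑ u, (X u k).toNat : ℕ) / Fintype.card V) := by
    refine ⟨Fintype.card V, fun k => ∑ u, (X u k).toNat, Fintype.card_pos, hN, ?_,
      fun _ => rfl, ?_⟩
    · intro k
      calc _ ≤ ∑ _u : V, 1 := Finset.sum_le_sum fun u _ => Bool.toNat_le _
        _ = _ := by simp
    · obtain ⟨g, hg, hg0, hq⟩ := hmean
      refine ⟨g, hg, hg0, fun q hqN => ?_⟩
      rw [Finset.sum_congr rfl fun i hi => by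
        rw [hs i (Nat.lt_succ_iff.1 (Finset.mem_range.1 hi))], hq q hqN]
      congr 2
      simp only [packBits]
      push_cast
      rw [Finset.sum_comm]
      simp only [Finset.sum_mul]
  rw [h.ratios_eq]


/-! ### Exact amplitude amplification -/

/-- With `p = b ^ 2`, the quantity is the probability that exactly one of `k + 1` independent bits
is set. It is `0` at `p = 0` and at least `1 / e > 1 / 4` at `p = 1 / (k + 1)`, so the intermediate
value theorem applies. -/
theorem exists_rotation_amplitudes (k : ℕ) :
    ∃ a b : ℝ, a ^ 2 + b ^ 2 = 1 ∧ (k + 1) * (b ^ 2 * (a ^ 2) ^ k) = 1 / 4 := by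
  let f : ℝ → ℝ := fun p => (k + 1) * (p * (1 - p) ^ k)
  have hf : ContinuousOn f (Set.Icc 0 (1 / (k + 1))) := by fun_prop
  have hk : (0 : ℝ) < k + 1 := by positivity
  have hle : (0 : ℝ) ≤ 1 / (k + 1) := by positivity
  have h1 : (1 : ℝ) / 4 ≤ f (1 / (k + 1)) := by
    have h2 : f (1 / (k + 1)) = (1 - 1 / ((k : ℝ) + 1)) ^ k := by
      simp only [f]
      field_simp
    rw [h2]
    rcases Nat.eq_zero_or_pos k with rfl | hk0
    · norm_num
    have hkr : (0 : ℝ) < k := by exact_mod_cast hk0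
    have h3 : (1 - 1 / ((k : ℝ) + 1)) = (1 + 1 / (k : ℝ))⁻¹ := by
      field_simp
      ring
    have h4 : (1 + 1 / (k : ℝ)) ^ k ≤ Real.exp 1 := by
      calc (1 + 1 / (k : ℝ)) ^ k ≤ Real.exp (1 / k) ^ k := by
            gcongr
            rw [add_comm]
            exact Real.add_one_le_exp _
        _ = Real.exp 1 := by
            rw [← Real.exp_nat_mul]
            congr 1
            field_simp
    have h5 : (1 + 1 / (k : ℝ)) ^ k ≤ 4 := h4.trans (by linarith [Real.exp_one_lt_d9])
    rw [h3, inv_pow, one_div]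
    exact inv_anti₀ (by positivity) h5
  have h0 : f 0 ≤ 1 / 4 := by
    simp [f]
  obtain ⟨p, hp, hfp⟩ := intermediate_value_Icc hle hf ⟨h0, h1⟩
  have hp1 : p ≤ 1 := hp.2.trans (by rw [div_le_one hk]; simp)
  refine ⟨√(1 - p), √p, ?_, ?_⟩
  · rw [Real.sq_sqrt (sub_nonneg.2 hp1), Real.sq_sqrt hp.1]
    ring
  · rw [Real.sq_sqrt (sub_nonneg.2 hp1), Real.sq_sqrt hp.1]
    exact hfp

/-- The rotation that sends `|0⟩` to `a|0⟩ + b|1⟩`. -/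
def rotation (a b : ℝ) : Matrix Bool Bool ℂ :=
  Matrix.of fun x y => if x = y then (a : ℂ) else if x then (b : ℂ) else -(b : ℂ)

theorem rotation_conjTranspose_mul {a b : ℝ} (h : a ^ 2 + b ^ 2 = 1) :
    (rotation a b)ᴴ * rotation a b = 1 := by
  have h' : (a : ℂ) ^ 2 + (b : ℂ) ^ 2 = 1 := by exact_mod_cast h
  ext x y
  cases x <;> cases y <;> simp [rotation, Matrix.mul_apply] <;>
    first | ring1 | linear_combination h'

theorem rotation_mul_conjTranspose {a b : ℝ} (h : a ^ 2 + b ^ 2 = 1) :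
    rotation a b * (rotation a b)ᴴ = 1 :=
  mul_eq_one_comm.1 (rotation_conjTranspose_mul h)

variable {V : Type} [Fintype V] [DecidableEq V]

theorem tensorMatrix_conjTranspose {ι : Type*} [Fintype ι] {α : ι → Type*}
    (M : ∀ i, Matrix (α i) (α i) ℂ) : tensorMatrix (fun i => (M i)ᴴ) = (tensorMatrix M)ᴴ := by
  ext a b
  simp [tensorMatrix]

/-- The number of parties whose bit is set. -/
def weight (x : V → Bool) : ℕ := ∑ u, (x u).toNat

omit [DecidableEq V] in
theorem weight_eq_zero {x : V → Bool} : weight x = 0 ↔ x = fun _ => false := by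
  simp [weight, funext_iff]

theorem weight_eq_one {x : V → Bool} : weight x = 1 ↔ ∃ v, x = fun u => decide (u = v) := by
  constructor
  · intro h
    have h0 : ∃ v, x v = true := by
      by_contra! hx
      rw [weight_eq_zero.2 (funext fun v => by simpa using hx v)] at h
      exact zero_ne_one h
    obtain ⟨v, hv⟩ := h0
    refine ⟨v, funext fun u => ?_⟩
    by_cases huv : u = v
    · simp [huv, hv]
    · rw [weight, ← Finset.add_sum_erase _ _ (Finset.mem_univ v), hv] at h
      have h1 : ∑ u ∈ Finset.univ.erase v, (x u).toNat = 0 := by simpa using h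
      rw [Finset.sum_eq_zero_iff] at h1
      have := h1 u (by simp [huv])
      simpa [huv] using this
  · rintro ⟨v, rfl⟩
    simp only [weight]
    rw [Finset.sum_eq_single v] <;> simp +contextual

theorem sum_sq_weight_one {a b : ℝ} (k : ℕ) (hV : Fintype.card V = k + 1) :
    ∑ x : V → Bool, (if weight x = 1 then
      (∏ v, (if x v then (b : ℂ) ^ 2 else (a : ℂ) ^ 2)) else 0) =
      (((k + 1) * (b ^ 2 * (a ^ 2) ^ k) : ℝ) : ℂ) := by
  have hinj : Function.Injective (fun v : V => (fun u => decide (u = v) : V → Bool)) := by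
    intro v w h
    have := congrFun h v
    simpa using this
  rw [← Finset.sum_filter]
  have himg : (Finset.univ.filter fun x : V → Bool => weight x = 1) =
      Finset.univ.image (fun v : V => (fun u => decide (u = v) : V → Bool)) := by
    ext x
    simp [weight_eq_one, eq_comm]
  rw [himg, Finset.sum_image (fun _ _ _ _ h => hinj h)]
  have hterm : ∀ v : V, (∏ u, if decide (u = v) = true then (b : ℂ) ^ 2 else (a : ℂ) ^ 2) =
      (b : ℂ) ^ 2 * ((a : ℂ) ^ 2) ^ k := by
    intro v
    rw [← Finset.mul_prod_erase _ _ (Finset.mem_univ v)]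
    rw [Finset.prod_congr rfl (g := fun _ => (a : ℂ) ^ 2) (by simp +contextual)]
    simp [Finset.card_erase_of_mem, hV]
  simp only [hterm, Finset.sum_const, Finset.card_univ, hV]
  push_cast
  simp

/-- One step of amplitude amplification, from success probability `1 / 4`, is exact. -/
theorem amplification_eq_zero {a b : ℝ} (hab : a ^ 2 + b ^ 2 = 1) (k : ℕ)
    (hk : (k + 1) * (b ^ 2 * (a ^ 2) ^ k) = 1 / 4) (hV : Fintype.card V = k + 1)
    {φ₁ φ₂ φ₃ φ₄ φ₅ : (V → Bool) → ℂ}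
    (h₁ : φ₁ = tensorMatrix (fun _ : V => rotation a b) *ᵥ Pi.single (fun _ => false) 1)
    (h₂ : ∀ x, φ₂ x = (if weight x = 1 then -1 else 1) * φ₁ x)
    (h₃ : φ₃ = tensorMatrix (fun _ : V => (rotation a b)ᴴ) *ᵥ φ₂)
    (h₄ : ∀ x, φ₄ x = (if weight x = 0 then -1 else 1) * φ₃ x)
    (h₅ : φ₅ = tensorMatrix (fun _ : V => rotation a b) *ᵥ φ₄)
    (x : V → Bool) (hx : weight x ≠ 1) : φ₅ x = 0 := by
  set M := tensorMatrix (fun _ : V => rotation a b) with hM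
  have hMM : Mᴴ * M = 1 := tensorMatrix_unitary _ fun _ => rotation_conjTranspose_mul hab
  have hMM' : M * Mᴴ = 1 := mul_eq_one_comm.1 hMM
  rw [tensorMatrix_conjTranspose, ← hM] at h₃
  have hφ₁ : ∀ y, φ₁ y = M y (fun _ => false) := by
    intro y
    rw [h₁, Matrix.mulVec_single_one]
    rfl
  have hstar : ∀ y, star (φ₁ y) * φ₁ y = ∏ v, if y v then (b : ℂ) ^ 2 else (a : ℂ) ^ 2 := by
    intro y
    rw [hφ₁, hM]
    simp only [tensorMatrix, Matrix.of_apply, star_prod, ← Finset.prod_mul_distrib]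
    refine Finset.prod_congr rfl fun v _ => ?_
    cases y v <;> simp [rotation, sq]
  have hnorm : ∑ y, star (φ₁ y) * φ₁ y = 1 := by
    have := congrFun (congrFun hMM fun _ => false) fun _ => false
    simp only [Matrix.mul_apply, Matrix.conjTranspose_apply, Matrix.one_apply_eq] at this
    simpa only [hφ₁] using this
  have hgood : ∑ y, (if weight y = 1 then star (φ₁ y) * φ₁ y else 0) = 1 / 4 := by
    simp only [hstar]
    rw [sum_sq_weight_one k hV, hk]
    norm_num
  -- This entry is `⟨φ₁, φ₂⟩ = 1 - 2 * (1 / 4)`.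
  have hφ₃ : φ₃ (fun _ => false) = 1 / 2 := by
    have h6 : φ₃ (fun _ => false) = ∑ y, star (φ₁ y) * φ₂ y := by
      rw [h₃]
      simp [Matrix.mulVec, dotProduct, hφ₁]
    have h7 : ∀ y, star (φ₁ y) * φ₂ y = star (φ₁ y) * φ₁ y -
        2 * (if weight y = 1 then star (φ₁ y) * φ₁ y else 0) := by
      intro y
      rw [h₂]
      split_ifs <;> ring
    rw [h6]
    simp only [h7, Finset.sum_sub_distrib, ← Finset.mul_sum, hgood, hnorm]
    norm_num
  -- Flipping the sign of an entry `1 / 2` subtracts exactly one basis vector, which the last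
  -- operator turns into `φ₁`; thus `φ₅ = φ₂ - φ₁`.
  have hφ₄ : φ₄ = φ₃ - Pi.single (fun _ => false) 1 := by
    ext y
    rw [h₄, Pi.sub_apply, Pi.single_apply]
    by_cases hy : y = fun _ => false
    · rw [if_pos (weight_eq_zero.2 hy), if_pos hy, hy, hφ₃]
      norm_num
    · rw [if_neg (fun h => hy (weight_eq_zero.1 h)), if_neg hy]
      ring
  rw [h₅, hφ₄, Matrix.mulVec_sub, h₃, Matrix.mulVec_mulVec, hMM', Matrix.one_mulVec, ← h₁,
    Pi.sub_apply, h₂, if_neg hx]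
  ring

/-- The guesses do not interact: a product over the guesses stays one under operators that act on
each bit separately. -/
theorem tensorMatrix_mulVec_prod {N : ℕ} (R : Fin N → Matrix Bool Bool ℂ)
    {Φ : (V → Fin N → Bool) → ℂ} {φ : Fin N → (V → Bool) → ℂ}
    (h : ∀ X, Φ X = ∏ k, φ k fun v => X v k) (X : V → Fin N → Bool) :
    (tensorMatrix (fun _ : V => tensorMatrix R) *ᵥ Φ) X =
      ∏ k, (tensorMatrix (fun _ : V => R k) *ᵥ φ k) fun v => X v k := by
  simp only [Matrix.mulVec, dotProduct, tensorMatrix, Matrix.of_apply]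
  rw [Finset.prod_univ_sum, Fintype.piFinset_univ, ← Equiv.sum_comp (Equiv.piComm _)]
  refine Finset.sum_congr rfl fun Y _ => ?_
  rw [Finset.prod_comm, h, ← Finset.prod_mul_distrib]
  rfl


/-! ### The algorithm -/

/-- The first `L` binary digits of a natural number, as a message. -/
def natWord (L m : ℕ) : Word L := ⟨Fin.last L, fun i => m.testBit i⟩

theorem natWord_injOn (L : ℕ) : Set.InjOn (natWord L) {m | m < 2 ^ L} := by
  intro m hm m' hm' h
  refine Nat.eq_of_testBit_eq fun i => ?_
  have h1 : (fun i : Fin L => m.testBit i) = fun i : Fin L => m'.testBit i := by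
    simpa [natWord] using h
  by_cases hi : i < L
  · exact congrFun h1 ⟨i, hi⟩
  · have hL : 2 ^ L ≤ 2 ^ i := Nat.pow_le_pow_right (by norm_num) (not_lt.1 hi)
    rw [Nat.testBit_eq_false_of_lt (lt_of_lt_of_le hm hL),
      Nat.testBit_eq_false_of_lt (lt_of_lt_of_le hm' hL)]

/-- The natural number that is encoded in a message. -/
noncomputable def wordNat {L : ℕ} (w : Word L) : ℕ :=
  Function.invFunOn (natWord L) {m | m < 2 ^ L} w

theorem wordNat_natWord {L m : ℕ} (h : m < 2 ^ L) : wordNat (natWord L m) = m :=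
  (natWord_injOn L).leftInvOn_invFunOn h

/-- The messages at the ports of a party. -/
abbrev Inbox (N d : ℕ) : Type := Fin d → Word (4 * N ^ 2)

/-- The memory of a party: one bit for every guess of the number of parties, and the messages
recorded so far. -/
abbrev Memory (N d : ℕ) : Type := (Fin N → Bool) × (Fin (2 * N + 1) → Option (Inbox N d))

/-- Memory and ports of a party. -/
abbrev PartyState (N d : ℕ) : Type := Memory N d × Inbox N d

instance (N d : ℕ) : DecidableEq (PartyState N d) := instDecidableEqProd

instance (N d : ℕ) : One (Matrix (PartyState N d) (PartyState N d) ℂ) := Matrix.one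

/-- The sequence of values of the averaging iteration at a party, reconstructed from its bits and
from the messages it has recorded. -/
noncomputable def averageSeq (N d : ℕ) (m : Memory N d) : ℕ → ℕ
  | 0 => packBits N m.1
  | t + 1 => (N - d) * averageSeq N d m t +
      ∑ p : Fin d, wordNat ((m.2 (Fin.ofNat _ (t + 1))).getD (fun _ => Word.empty _) p)

/-- Record the incoming messages in slot `j`. -/
def record (N d j : ℕ) (s : PartyState N d) : Memory N d :=
  (s.1.1, Function.update s.1.2 (Fin.ofNat _ j) (some s.2))

/-- Record the incoming messages and send the current value of the averaging iteration. -/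
noncomputable def recordAndSend (N d j : ℕ) (s : PartyState N d) : PartyState N d :=
  (record N d j s, fun _ => natWord _ (averageSeq N d (record N d j s) j))

/-- The overwritten inbox survives in slot `j`, so nothing is lost if that slot was empty; an
injection on a subset of a finite set extends to a permutation. -/
theorem exists_perm_recordAndSend (N d j : ℕ) : ∃ π : Equiv.Perm (PartyState N d),
    ∀ s, s.1.2 (Fin.ofNat _ j) = none → π s = recordAndSend N d j s := by
  have hinj : Set.InjOn (recordAndSend N d j) {s | s.1.2 (Fin.ofNat _ j) = none} := by
    rintro ⟨⟨x, h⟩, p⟩ hs ⟨⟨x', h'⟩, p'⟩ hs' heq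
    simp only [recordAndSend, record, Prod.mk.injEq] at heq
    obtain ⟨⟨hx, hu⟩, -⟩ := heq
    have hp : p = p' := by
      have := congrFun hu (Fin.ofNat _ j)
      simpa using this
    have hh : h = h' := by
      funext i
      by_cases hi : i = Fin.ofNat _ j
      · rw [hi]
        exact hs.trans hs'.symm
      · have := congrFun hu i
        rwa [Function.update_of_ne hi, Function.update_of_ne hi] at this
    rw [hx, hp, hh]
  obtain ⟨g, hg⟩ := Set.MapsTo.exists_equiv_extend_of_card_eq
    (t := (Finset.univ : Finset (PartyState N d))) (by simp)
    (f := recordAndSend N d j) (s := {s | s.1.2 (Fin.ofNat _ j) = none}) (fun _ _ => by simp) hinj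
  exact ⟨g.trans (Equiv.subtypeUnivEquiv fun _ => Finset.mem_univ _), fun s hs => hg s hs⟩

/-- A reversible extension of `recordAndSend`. -/
noncomputable def sendPerm (N d j : ℕ) : Equiv.Perm (PartyState N d) :=
  (exists_perm_recordAndSend N d j).choose

theorem sendPerm_apply {N d j : ℕ} {s : PartyState N d} (hs : s.1.2 (Fin.ofNat _ j) = none) :
    sendPerm N d j s = recordAndSend N d j s :=
  (exists_perm_recordAndSend N d j).choose_spec s hs

/-- The rotation by which bit `k` is prepared. -/
noncomputable def guessRotation (k : ℕ) : Matrix Bool Bool ℂ :=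
  rotation (exists_rotation_amplitudes k).choose (exists_rotation_amplitudes k).choose_spec.choose

/-- The operator that prepares the bits of a party (in the round blocks `q ≠ 1`), or its inverse
(in the block `q = 1`). -/
noncomputable def guessMatrix (N q : ℕ) (k : Fin N) : Matrix Bool Bool ℂ :=
  if q = 1 then (guessRotation k)ᴴ else guessRotation k

theorem guessMatrix_unitary (N q : ℕ) (k : Fin N) :
    (guessMatrix N q k)ᴴ * guessMatrix N q k = 1 := by
  have h := (exists_rotation_amplitudes k).choose_spec.choose_spec.1
  unfold guessMatrix
  split_ifs
  · rw [Matrix.conjTranspose_conjTranspose]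
    exact rotation_mul_conjTranspose h
  · exact rotation_conjTranspose_mul h

/-- The operator `M` on the bits of a party. -/
def bitsGate (N d : ℕ) (M : Matrix (Fin N → Bool) (Fin N → Bool) ℂ) :
    Matrix (PartyState N d) (PartyState N d) ℂ :=
  (Matrix.kronecker M (1 : Matrix ((Fin (2 * N + 1) → Option (Inbox N d)) × Inbox N d) _ ℂ)).submatrix
    (Equiv.prodAssoc _ _ _) (Equiv.prodAssoc _ _ _)

theorem bitsGate_unitary {N d : ℕ} {M : Matrix (Fin N → Bool) (Fin N → Bool) ℂ}
    (hM : Mᴴ * M = 1) : (bitsGate N d M)ᴴ * bitsGate N d M = 1 := by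
  rw [bitsGate, Matrix.conjTranspose_submatrix, Matrix.submatrix_mul_equiv,
    Matrix.kronecker, Matrix.conjTranspose_kronecker, ← Matrix.mul_kronecker_mul, hM]
  simp [Matrix.submatrix_one_equiv]

open Classical in
/-- The phase by which a party marks, for every guess `k + 1` of the number of parties, that `c`
parties have bit `k` set. -/
noncomputable def phase (N : ℕ) (c : ℕ) (w : Fin N → ℚ) : ℂ :=
  ∏ k : Fin N, if w k * (k + 1) = c then Complex.exp (Real.pi * Complex.I / (k + 1)) else 1

theorem star_phase_mul_phase (N c : ℕ) (w : Fin N → ℚ) : star (phase N c w) * phase N c w = 1 := by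
  rw [phase, star_prod, ← Finset.prod_mul_distrib]
  refine Finset.prod_eq_one fun k _ => ?_
  split_ifs
  · have h : (Real.pi * Complex.I / ((k : ℂ) + 1)) =
        ((Real.pi / ((k : ℝ) + 1) : ℝ) : ℂ) * Complex.I := by
      push_cast
      ring
    rw [h, Complex.star_def, ← Complex.exp_conj, ← Complex.exp_add]
    simp
  · simp

/-- The proportions that a party has learned when the last messages have arrived. -/
noncomputable def learnedRatios (N d : ℕ) (m : Memory N d) : Fin N → ℚ :=
  ratios N (averageSeq N d m)

/-- The local operator of round `r`. -/
noncomputable def gate (N d r : ℕ) : Matrix (PartyState N d) (PartyState N d) ℂ :=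
  if r % (4 * N + 2) = 0 then bitsGate N d (tensorMatrix (guessMatrix N (r / (4 * N + 2))))
  else if r % (4 * N + 2) ≤ 2 * N then
    monomialMatrix (sendPerm N d (r % (4 * N + 2) - 1)) fun _ => 1
  else if r % (4 * N + 2) = 2 * N + 1 then
    -- The third block is the last one: the final messages are recorded and nothing is undone.
    if r / (4 * N + 2) = 2 then monomialMatrix (sendPerm N d (2 * N)) fun _ => 1
    -- Block `0` marks weight one and block `1` marks weight zero. The messages stay at the ports,
    -- so the transmission returns them to their senders.
    else monomialMatrix id fun s =>
      phase N (1 - r / (4 * N + 2)) (learnedRatios N d (record N d (2 * N) s))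
  -- The sending rounds are reversed, with slots running from `2 * N - 1` down to `0`.
  else monomialMatrix (sendPerm N d (4 * N + 1 - r % (4 * N + 2))).symm fun _ => 1

theorem gate_unitary (N d r : ℕ) : (gate N d r)ᴴ * gate N d r = 1 := by
  unfold gate
  split_ifs
  · exact bitsGate_unitary (tensorMatrix_unitary _ fun k => guessMatrix_unitary _ _ k)
  · exact monomialMatrix_unitary (Equiv.injective _) (by simp)
  · exact monomialMatrix_unitary (Equiv.injective _) (by simp)
  · exact monomialMatrix_unitary Function.injective_id fun _ => star_phase_mul_phase _ _ _
  · exact monomialMatrix_unitary (Equiv.injective _) (by simp)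

/-- A party with bits `x` that has learned the proportions `w` becomes the leader. -/
def Wins {N : ℕ} (w : Fin N → ℚ) (x : Fin N → Bool) : Prop :=
  ∃ k : Fin N, x k = true ∧ w k = 1 / (k + 1) ∧ ∀ j, w j ≠ 0 → 1 / ((k : ℚ) + 1) ≤ w j

/-- The leader election algorithm for at most `N` parties. -/
noncomputable def electionAlgorithm (N : ℕ) : Algorithm where
  State := Memory N
  fintypeState := inferInstance
  decEqState := inferInstance
  maxLength := 4 * N ^ 2
  init := fun _ => (fun _ => false, fun _ => none)
  step := fun d r => unitaryChannel (gate N d r) (gate_unitary N d r)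
  -- The empty last slot makes the output variable initially `1`; the last round fills this slot.
  output := fun d m => @decide (m.2 (Fin.last _) = none ∨ Wins (learnedRatios N d m) m.1) (Classical.dec _)
  -- Two blocks of `4 * N + 2` rounds, then `2 * N + 2` rounds of a third.
  rounds := 10 * N + 6

/-! ### The averaging iteration on basis states -/

section Run

variable {V : Type} [Fintype V] {G : SimpleGraph V} [DecidableRel G.Adj]

/-- The configuration, for the initial bits `X`, after `t` rounds of the averaging iteration. -/
noncomputable def averagingConfig {N : ℕ} (σ : PortNumbering G) (X : V → Fin N → Bool) :
    ℕ → (electionAlgorithm N).Config G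
  | 0 => fun v => ((X v, fun _ => none), fun _ => Word.empty _)
  | t + 1 => (electionAlgorithm N).exchange σ fun v => sendPerm N _ t (averagingConfig σ X t v)

/-- The values of the averaging iteration for the bits `X`. -/
def averagingValue {N : ℕ} (G : SimpleGraph V) [DecidableRel G.Adj] (X : V → Fin N → Bool)
    (t : ℕ) : V → ℕ :=
  (averagingStep G N)^[t] fun u => packBits N (X u)

/-- The messages that arrive at a party after `t` rounds of the averaging iteration. -/
def averagingInbox {N : ℕ} (σ : PortNumbering G) (X : V → Fin N → Bool) :
    ℕ → ∀ v, Inbox N (G.degree v)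
  | 0 => fun _ _ => Word.empty _
  | t + 1 => fun v p => natWord _ (averagingValue G X t (σ v p))

variable {N : ℕ} (σ : PortNumbering G) (X : V → Fin N → Bool)

/-- This fixes the message length: the packed bits and the growth factor `N ^ t` contribute `2 * N ^
2` binary digits each. -/
theorem averagingValue_lt (hN : Fintype.card V ≤ N) {t : ℕ} (ht : t ≤ 2 * N) (v : V) :
    averagingValue G X t v < 2 ^ (4 * N ^ 2) := by
  have hdeg : ∀ v, G.degree v ≤ N := fun v => (G.degree_lt_card_verts v).le.trans hN
  have h1 := averagingStep_iterate_le hdeg (b := (4 ^ N) ^ N - 1)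
    (fun u => Nat.le_sub_one_of_lt (packBits_lt N (X u))) t v
  have hN0 : 0 < N := (Fintype.card_pos_iff.2 ⟨v⟩).trans_le hN
  have h2 : N ^ t ≤ (2 ^ N) ^ (2 * N) :=
    (Nat.pow_le_pow_right hN0 ht).trans (Nat.pow_le_pow_left Nat.lt_two_pow_self.le _)
  calc averagingValue G X t v ≤ N ^ t * ((4 ^ N) ^ N - 1) := h1
    _ ≤ (2 ^ N) ^ (2 * N) * ((4 ^ N) ^ N - 1) := Nat.mul_le_mul_right _ h2
    _ < (2 ^ N) ^ (2 * N) * (4 ^ N) ^ N := by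
        have : 0 < (4 ^ N) ^ N := by positivity
        exact Nat.mul_lt_mul_of_pos_left (by omega) (by positivity)
    _ = 2 ^ (4 * N ^ 2) := by
        rw [show (4 : ℕ) = 2 ^ 2 from rfl]
        simp only [← pow_mul, ← pow_add]
        congr 1
        ring

/-- A party can replay its own values from its bits and its records, since the messages are long
enough to carry the values of its neighbours without truncation. -/
theorem averageSeq_eq (hN : Fintype.card V ≤ N) (v : V) {m : Memory N (G.degree v)}
    (hm : m.1 = X v) {j : ℕ} (hj : j ≤ 2 * N)
    (h : ∀ i < j, m.2 (Fin.ofNat _ (i + 1)) = some (averagingInbox σ X (i + 1) v)) :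
    averageSeq N _ m j = averagingValue G X j v := by
  induction j with
  | zero => simp [averageSeq, averagingValue, hm]
  | succ j ih =>
    rw [averageSeq, ih (by omega) fun i hi => h i (by omega), h j (by omega), averagingValue, averagingValue,
      Function.iterate_succ_apply', averagingStep]
    congr 1
    have h1 : ∀ u, wordNat (natWord (4 * N ^ 2) (averagingValue G X j u)) =
        averagingValue G X j u := fun u => wordNat_natWord (averagingValue_lt X hN (by omega) u)
    simp only [Option.getD_some, averagingInbox, h1]
    rw [Equiv.sum_comp (σ v) fun u => averagingValue G X j u, Finset.sum_set_coe]
    rfl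

theorem averagingConfig_eq (hN : Fintype.card V ≤ N) {t : ℕ} (ht : t ≤ 2 * N + 1) :
    averagingConfig σ X t = fun v => ((X v, fun i : Fin (2 * N + 1) =>
      if (i : ℕ) < t then some (averagingInbox σ X i v) else none), averagingInbox σ X t v) := by
  induction t with
  | zero =>
    simp only [averagingConfig, averagingInbox, Nat.not_lt_zero, if_false]
    rfl
  | succ t ih =>
    rw [averagingConfig, ih (by omega)]
    have hval : ∀ i, i ≤ 2 * N → ((Fin.ofNat (2 * N + 1) i : Fin (2 * N + 1)) : ℕ) = i :=
      fun i hi => Nat.mod_eq_of_lt (by omega)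
    have hstep : ∀ v, sendPerm N (G.degree v) t ((X v, fun i : Fin (2 * N + 1) =>
        if (i : ℕ) < t then some (averagingInbox σ X i v) else none), averagingInbox σ X t v) =
        ((X v, fun i : Fin (2 * N + 1) =>
          if (i : ℕ) < t + 1 then some (averagingInbox σ X i v) else none),
          fun _ => natWord _ (averagingValue G X t v)) := by
      intro v
      have hrec : record N (G.degree v) t ((X v, fun i : Fin (2 * N + 1) =>
          if (i : ℕ) < t then some (averagingInbox σ X i v) else none), averagingInbox σ X t v) =
          (X v, fun i : Fin (2 * N + 1) =>
            if (i : ℕ) < t + 1 then some (averagingInbox σ X i v) else none) := by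
        refine Prod.ext rfl (funext fun i => ?_)
        simp only [record]
        by_cases hi : i = Fin.ofNat _ t
        · subst hi
          rw [Function.update_self, hval t (by omega), if_pos (by omega)]
        · have : (i : ℕ) ≠ t := fun h => hi (Fin.ext (h.trans (hval t (by omega)).symm))
          rw [Function.update_of_ne hi]
          exact if_congr (by omega) rfl rfl
      rw [sendPerm_apply (by simp only [hval t (by omega)]; simp), recordAndSend, hrec,
        averageSeq_eq σ X hN v rfl (by omega)]
      intro i hi
      simp only [hval (i + 1) (by omega)]
      rw [if_pos (by omega)]
    funext v
    refine Prod.ext ?_ (funext fun p => ?_)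
    · exact (congrArg Prod.fst (hstep v) :)
    · exact (congrFun (congrArg Prod.snd (hstep (σ v p : V))) _ :)

/-- The memory of a party at the end of the averaging iteration. -/
def finalMemory (v : V) : Memory N (G.degree v) :=
  (X v, fun i => some (averagingInbox σ X i v))

theorem record_averagingConfig (hN : Fintype.card V ≤ N) (v : V) :
    record N _ (2 * N) (averagingConfig σ X (2 * N) v) = finalMemory σ X v := by
  rw [averagingConfig_eq σ X hN (by omega)]
  refine Prod.ext rfl (funext fun i => ?_)
  have hval : ((Fin.ofNat (2 * N + 1) (2 * N) : Fin (2 * N + 1)) : ℕ) = 2 * N :=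
    Nat.mod_eq_of_lt (by omega)
  simp only [record, finalMemory]
  by_cases hi : i = Fin.ofNat _ (2 * N)
  · subst hi
    rw [Function.update_self, hval]
  · have : (i : ℕ) ≠ 2 * N := fun h => hi (Fin.ext (h.trans hval.symm))
    rw [Function.update_of_ne hi, if_pos (by omega)]

theorem averagingConfig_final (hN : Fintype.card V ≤ N) (v : V) :
    (averagingConfig σ X (2 * N + 1) v).1 = finalMemory σ X v := by
  rw [averagingConfig_eq σ X hN le_rfl]
  refine Prod.ext rfl (funext fun i => ?_)
  simp only [finalMemory, if_pos i.2]

theorem learnedRatios_finalMemory [DecidableEq V] (hG : G.Connected) (hN : Fintype.card V ≤ N)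
    (v : V) (k : Fin N) :
    learnedRatios N _ (finalMemory σ X v) k = weight (fun u => X u k) / Fintype.card V := by
  refine ratios_averaging hG hN X v (fun t ht => ?_) k
  refine averageSeq_eq σ X hN v rfl ht fun i hi => ?_
  have hval : ((Fin.ofNat (2 * N + 1) (i + 1) : Fin (2 * N + 1)) : ℕ) = i + 1 :=
    Nat.mod_eq_of_lt (by omega)
  simp only [finalMemory, hval]

end Run

/-! ### Evolution of the state vector -/

/-- A party with bits `x` and nothing recorded. -/
def freshState (N d : ℕ) (x : Fin N → Bool) : PartyState N d :=
  ((x, fun _ => none), fun _ => Word.empty _)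

theorem bitsGate_freshState (N d : ℕ) (M : Matrix (Fin N → Bool) (Fin N → Bool) ℂ)
    (a : PartyState N d) (y : Fin N → Bool) :
    bitsGate N d M a (freshState N d y) = ∑ x, if a = freshState N d x then M x y else 0 := by
  obtain ⟨⟨x, h⟩, p⟩ := a
  simp only [bitsGate, freshState, Matrix.submatrix_apply, Matrix.kronecker,
    Matrix.kroneckerMap_apply, Equiv.prodAssoc_apply, Matrix.one_apply, Prod.mk.injEq]
  by_cases hp : h = (fun _ => none) ∧ p = fun _ => Word.empty _
  · obtain ⟨rfl, rfl⟩ := hp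
    simp
  · rw [if_neg hp, mul_zero, eq_comm]
    exact Finset.sum_eq_zero fun x' _ => if_neg fun h' => hp ⟨h'.1.2, h'.2⟩

theorem gate_of_block {N d q s : ℕ} (hs : s < 4 * N + 2) :
    gate N d (q * (4 * N + 2) + s) =
      if s = 0 then bitsGate N d (tensorMatrix (guessMatrix N q))
      else if s ≤ 2 * N then monomialMatrix (sendPerm N d (s - 1)) fun _ => 1
      else if s = 2 * N + 1 then
        if q = 2 then monomialMatrix (sendPerm N d (2 * N)) fun _ => 1
        else monomialMatrix id fun s =>
          phase N (1 - q) (learnedRatios N d (record N d (2 * N) s))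
      else monomialMatrix (sendPerm N d (4 * N + 1 - s)).symm fun _ => 1 := by
  have h1 : (q * (4 * N + 2) + s) % (4 * N + 2) = s := by
    rw [add_comm, Nat.add_mul_mod_self_right, Nat.mod_eq_of_lt hs]
  have h2 : (q * (4 * N + 2) + s) / (4 * N + 2) = q := by
    rw [add_comm, Nat.add_mul_div_right _ _ (by omega), Nat.div_eq_of_lt hs, zero_add]
  rw [gate, h1, h2]

section Run

open Algorithm

variable {V : Type} [Fintype V] [DecidableEq V] {G : SimpleGraph V} [DecidableRel G.Adj]

/-- The local operators of the algorithm. -/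
noncomputable def localGates (N : ℕ) : ∀ d, ℕ →
    Matrix ((electionAlgorithm N).Local d) ((electionAlgorithm N).Local d) ℂ :=
  fun d r => gate N d r

theorem electionAlgorithm_isUnitary (N : ℕ) : (electionAlgorithm N).IsUnitary (localGates N) :=
  fun d r => ⟨gate_unitary N d r, rfl⟩

/-- The state vector of the network after `r` rounds. -/
noncomputable def networkState (N : ℕ) (σ : PortNumbering G) (r : ℕ) :
    (electionAlgorithm N).Config G → ℂ :=
  amplitude (localGates N) σ r

variable {N : ℕ} {σ : PortNumbering G} {Φ : (V → Fin N → Bool) → ℂ}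

omit [DecidableEq V] in
theorem exchange_averagingConfig_zero (X : V → Fin N → Bool) :
    (electionAlgorithm N).exchange σ (averagingConfig σ X 0) = averagingConfig σ X 0 := rfl

/-- The state vector at the beginning of a block of rounds, after the operator on the bits. -/
theorem networkState_bits (q : ℕ)
    (h : networkState N σ (q * (4 * N + 2)) = encode (fun X => averagingConfig σ X 0) Φ) :
    networkState N σ (q * (4 * N + 2) + 1) = encode (fun X => averagingConfig σ X 0)
      (tensorMatrix (fun _ : V => tensorMatrix (guessMatrix N q)) *ᵥ Φ) := by
  refine amplitude_succ_product (A := electionAlgorithm N) (freshState N) (fun X => rfl) h _ ?_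
  intro d a y
  refine Eq.trans ?_ (bitsGate_freshState N d _ a y)
  have := gate_of_block (N := N) (d := d) (q := q) (s := 0) (by omega)
  rw [if_pos rfl] at this
  exact congrFun (congrFun this a) _

theorem networkState_monomial {e : (V → Fin N → Bool) → (electionAlgorithm N).Config G} {r : ℕ}
    (h : networkState N σ r = encode e Φ)
    (π : ∀ d, PartyState N d → PartyState N d) (θ : ∀ d, PartyState N d → ℂ)
    (hr : ∀ d, gate N d r = monomialMatrix (π d) (θ d)) :
    networkState N σ (r + 1) =
      encode (fun X => (electionAlgorithm N).exchange σ fun v => π _ (e X v))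
        (fun X => (∏ v, θ _ (e X v)) * Φ X) :=
  amplitude_succ_monomial h π θ hr

theorem networkState_permutation
    {e : (V → Fin N → Bool) → (electionAlgorithm N).Config G} {r : ℕ}
    (h : networkState N σ r = encode e Φ) (π : ∀ d, PartyState N d → PartyState N d)
    (hr : ∀ d, gate N d r = monomialMatrix (π d) fun _ => 1) :
    networkState N σ (r + 1) =
      encode (fun X => (electionAlgorithm N).exchange σ fun v => π _ (e X v)) Φ := by
  rw [networkState_monomial h π _ hr]
  simp

theorem networkState_averaging (q : ℕ)
    (h : networkState N σ (q * (4 * N + 2) + 1) = encode (fun X => averagingConfig σ X 0) Φ)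
    {t : ℕ} (ht : t ≤ 2 * N) :
    networkState N σ (q * (4 * N + 2) + (t + 1)) = encode (fun X => averagingConfig σ X t) Φ := by
  induction t with
  | zero => exact h
  | succ t ih =>
    refine networkState_permutation (ih (by omega)) (fun d => sendPerm N d t) fun d => ?_
    rw [gate_of_block (by omega), if_neg (by omega), if_pos (by omega), Nat.add_sub_cancel]

theorem networkState_phase {q : ℕ} (hq : q ≠ 2)
    (h : networkState N σ (q * (4 * N + 2) + (2 * N + 1)) =
      encode (fun X => averagingConfig σ X (2 * N)) Φ) :
    networkState N σ (q * (4 * N + 2) + (2 * N + 2)) =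
      encode (fun X => (electionAlgorithm N).exchange σ (averagingConfig σ X (2 * N)))
        fun X => (∏ v, phase N (1 - q) (learnedRatios N _
          (record N (G.degree v) (2 * N) (averagingConfig σ X (2 * N) v)))) * Φ X := by
  refine networkState_monomial h (fun d => id) (fun d s =>
    phase N (1 - q) (learnedRatios N d (record N d (2 * N) s))) fun d => ?_
  rw [gate_of_block (by omega), if_neg (by omega), if_neg (by omega), if_pos rfl, if_neg hq]

/-- Transmission is an involution and the phase round leaves the messages alone. So each message is
back at the port it was sent from, where the inverse of the sending permutation cancels it. -/
theorem networkState_uncompute (q : ℕ)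
    (h : networkState N σ (q * (4 * N + 2) + (2 * N + 2)) =
      encode (fun X => (electionAlgorithm N).exchange σ (averagingConfig σ X (2 * N))) Φ)
    {t : ℕ} (ht : t ≤ 2 * N) :
    networkState N σ (q * (4 * N + 2) + (2 * N + 2 + t)) =
      encode (fun X => (electionAlgorithm N).exchange σ (averagingConfig σ X (2 * N - t))) Φ := by
  induction t with
  | zero => exact h
  | succ t ih =>
    have hstep := networkState_permutation (ih (by omega))
      (fun d => (sendPerm N d (2 * N - (t + 1))).symm) fun d => by
        rw [gate_of_block (by omega), if_neg (by omega), if_neg (by omega), if_neg (by omega),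
          show 4 * N + 1 - (2 * N + 2 + t) = 2 * N - (t + 1) by omega]
    refine hstep.trans (congrArg (fun e => encode e Φ) (funext fun X => ?_))
    congr 1
    funext v
    rw [show 2 * N - t = 2 * N - (t + 1) + 1 by omega]
    have hinv := congrFun ((electionAlgorithm N).exchange_involutive σ fun v =>
      sendPerm N _ (2 * N - (t + 1)) (averagingConfig σ X (2 * N - (t + 1)) v)) v
    exact (congrArg (sendPerm N _ (2 * N - (t + 1))).symm hinv).trans
      (Equiv.symm_apply_apply _ _)

theorem networkState_block {q : ℕ} (hq : q ≠ 2) (hN : Fintype.card V ≤ N)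
    (h : networkState N σ (q * (4 * N + 2)) = encode (fun X => averagingConfig σ X 0) Φ) :
    networkState N σ ((q + 1) * (4 * N + 2)) = encode (fun X => averagingConfig σ X 0)
      fun X => (∏ v, phase N (1 - q) (learnedRatios N _ (finalMemory σ X v))) *
        (tensorMatrix (fun _ : V => tensorMatrix (guessMatrix N q)) *ᵥ Φ) X := by
  have h1 := networkState_averaging q (networkState_bits q h) le_rfl
  have h2 := networkState_uncompute q (networkState_phase hq h1) le_rfl
  simp only [Nat.sub_self, exchange_averagingConfig_zero, record_averagingConfig σ _ hN] at h2
  rw [← h2]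
  congr 1
  ring

theorem networkState_zero :
    networkState N σ 0 = encode (fun X => averagingConfig σ X 0)
      (Pi.single (fun _ _ => false) 1) := by
  funext c
  have : (∑ X : V → Fin N → Bool, if c = averagingConfig σ X 0 then
      (Pi.single (fun _ _ => false) 1 : (V → Fin N → Bool) → ℂ) X else 0) =
      if c = averagingConfig σ (fun _ _ => false) 0 then 1 else 0 := by
    rw [Finset.sum_eq_single (fun _ _ => false)]
    · simp
    · intro X _ hX
      simp [hX]
    · simp
  rw [encode, this, networkState, amplitude, Pi.single_apply]
  rfl

/-- At the end, the amplitude of the bits vanishes unless exactly one party has the bit set that belongs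
to the right guess of the number of parties. -/
theorem networkState_final (hG : G.Connected) (hN : Fintype.card V ≤ N) :
    ∃ Φ : (V → Fin N → Bool) → ℂ,
      networkState N σ (10 * N + 6) = encode (fun X => averagingConfig σ X (2 * N + 1)) Φ ∧
      ∀ (X : V → Fin N → Bool) (k : Fin N), (k : ℕ) + 1 = Fintype.card V →
        weight (fun u => X u k) ≠ 1 → Φ X = 0 := by
  -- All parties learn the same proportions, so their phases combine to an `n`-th power, which
  -- factors over the guesses.
  have hphase : ∀ (c : ℕ) (X : V → Fin N → Bool),
      ∏ v, phase N c (learnedRatios N _ (finalMemory σ X v)) =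
        ∏ k : Fin N, (if (weight (fun u => X u k) : ℚ) / Fintype.card V * (k + 1) = c then
          Complex.exp (Real.pi * Complex.I / (k + 1)) else 1) ^ Fintype.card V := by
    intro c X
    have : ∀ v, learnedRatios N _ (finalMemory σ X v) =
        fun k => (weight (fun u => X u k) : ℚ) / Fintype.card V :=
      fun v => funext fun k => learnedRatios_finalMemory σ X hG hN v k
    simp only [this, Finset.prod_const, Finset.card_univ, phase, Finset.prod_pow]
  -- The factor of the state that belongs to guess `k`, followed through both blocks and the final
  -- rotation; `D c k` is the joint phase of all parties.
  let φ₀ : (V → Bool) → ℂ := Pi.single (fun _ => false) 1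
  let D : ℕ → Fin N → (V → Bool) → ℂ := fun c k x =>
    (if (weight x : ℚ) / Fintype.card V * (k + 1) = c then
      Complex.exp (Real.pi * Complex.I / (k + 1)) else 1) ^ Fintype.card V
  let φ₁ : Fin N → (V → Bool) → ℂ := fun k =>
    tensorMatrix (fun _ : V => guessMatrix N 0 k) *ᵥ φ₀
  let φ₂ : Fin N → (V → Bool) → ℂ := fun k x => D 1 k x * φ₁ k x
  let φ₃ : Fin N → (V → Bool) → ℂ := fun k =>
    tensorMatrix (fun _ : V => guessMatrix N 1 k) *ᵥ φ₂ k
  let φ₄ : Fin N → (V → Bool) → ℂ := fun k x => D 0 k x * φ₃ k x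
  let φ₅ : Fin N → (V → Bool) → ℂ := fun k =>
    tensorMatrix (fun _ : V => guessMatrix N 2 k) *ᵥ φ₄ k
  have h0 : ∀ X : V → Fin N → Bool, (Pi.single (fun _ _ => false) 1 : (V → Fin N → Bool) → ℂ) X =
      ∏ k, φ₀ fun v => X v k := by
    intro X
    simp only [φ₀, Pi.single_apply]
    rw [Finset.prod_ite_zero]
    simp only [Finset.prod_const_one]
    refine if_congr ?_ rfl rfl
    simp only [funext_iff, Finset.mem_univ, true_implies]
    exact forall_comm
  have hA := networkState_block (q := 0) (by norm_num) hN
    ((congrArg (networkState N σ) (zero_mul _)).trans networkState_zero)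
  have h2 : ∀ X : V → Fin N → Bool,
      (∏ v, phase N (1 - 0) (learnedRatios N _ (finalMemory σ X v))) *
        (tensorMatrix (fun _ : V => tensorMatrix (guessMatrix N 0)) *ᵥ
          (Pi.single (fun _ _ => false) 1)) X = ∏ k, φ₂ k fun v => X v k := by
    intro X
    rw [hphase, tensorMatrix_mulVec_prod _ h0, ← Finset.prod_mul_distrib]
  have hB := networkState_block (q := 1) (by norm_num) hN hA
  have h4 : ∀ X : V → Fin N → Bool,
      (∏ v, phase N (1 - 1) (learnedRatios N _ (finalMemory σ X v))) *
        (tensorMatrix (fun _ : V => tensorMatrix (guessMatrix N 1)) *ᵥ fun X =>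
          (∏ v, phase N (1 - 0) (learnedRatios N _ (finalMemory σ X v))) *
            (tensorMatrix (fun _ : V => tensorMatrix (guessMatrix N 0)) *ᵥ
              (Pi.single (fun _ _ => false) 1)) X) X = ∏ k, φ₄ k fun v => X v k := by
    intro X
    exact (congrArg₂ (· * ·) (hphase (1 - 1) X) (tensorMatrix_mulVec_prod _ h2 X)).trans
      Finset.prod_mul_distrib.symm
  have hC := networkState_averaging 2 (networkState_bits 2 hB) le_rfl
  have hD := networkState_permutation hC (fun d => sendPerm N d (2 * N)) fun d => by
    rw [gate_of_block (by omega), if_neg (by omega), if_neg (by omega), if_pos rfl, if_pos rfl]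
  refine ⟨_, (congrArg (networkState N σ) (by ring)).trans hD, fun X k hk hX => ?_⟩
  rw [tensorMatrix_mulVec_prod _ h4]
  -- One vanishing factor suffices, so the factors of wrong guesses need not be understood.
  refine Finset.prod_eq_zero (Finset.mem_univ k) ?_
  have hspec := (exists_rotation_amplitudes k).choose_spec.choose_spec
  have hcard : ((k : ℚ) + 1) = Fintype.card V := by exact_mod_cast hk
  have hcard0 : (Fintype.card V : ℚ) ≠ 0 := by
    rw [← hcard]
    positivity
  -- For the right guess the joint phase is `exp(iπ / n) ^ n = -1`, the sign flip of the
  -- amplification.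
  have hDk : ∀ (c : ℕ) (x : V → Bool), D c k x = if weight x = c then -1 else 1 := by
    intro c x
    have hexp : Complex.exp (Real.pi * Complex.I / (k + 1)) ^ Fintype.card V = -1 := by
      rw [← Complex.exp_nat_mul, ← hk]
      have : ((k : ℂ) + 1) ≠ 0 := by exact_mod_cast Nat.succ_ne_zero k
      push_cast
      rw [mul_div_cancel₀ _ this, Complex.exp_pi_mul_I]
    simp only [D, hcard, div_mul_cancel₀ _ hcard0, Nat.cast_inj]
    split_ifs
    · exact hexp
    · exact one_pow _
  exact amplification_eq_zero hspec.1 k hspec.2 hk.symm (φ₁ := φ₁ k) (φ₂ := φ₂ k) (φ₃ := φ₃ k)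
    (φ₄ := φ₄ k) (φ₅ := φ₅ k) rfl (fun x => by rw [← hDk]) rfl (fun x => by rw [← hDk]) rfl _ hX

/-! ### Choosing the leader -/

/-- Among `n` parties the least possible nonzero proportion is `1 / n`, and the right guess attains
it. A guess `j` whose proportion is `1 / (j + 1)` and least among the nonzero ones therefore has `j
+ 1 = n`. -/
theorem wins_iff {w : Fin N → ℚ} {c : Fin N → ℕ} {n : ℕ} (hn : 0 < n)
    (hw : ∀ k, w k = c k / n) {k : Fin N} (hk : (k : ℕ) + 1 = n) (hc : c k = 1)
    (x : Fin N → Bool) : Wins w x ↔ x k = true := by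
  have hn' : (0 : ℚ) < n := by exact_mod_cast hn
  have hkn : (k : ℚ) + 1 = n := by exact_mod_cast hk
  have hwk : w k = 1 / n := by rw [hw, hc, Nat.cast_one]
  have hmin : ∀ j, w j ≠ 0 → (1 : ℚ) / n ≤ w j := by
    intro j hj
    rw [hw] at hj ⊢
    have : c j ≠ 0 := fun h => hj (by simp [h])
    have : (1 : ℚ) ≤ c j := by exact_mod_cast Nat.one_le_iff_ne_zero.2 this
    gcongr
  constructor
  · rintro ⟨j, hxj, hwj, hj⟩
    have hj0 : (0 : ℚ) < (j : ℚ) + 1 := by positivity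
    have h1 := hj k (by rw [hwk]; positivity)
    have h2 := hmin j (by rw [hwj]; positivity)
    rw [hwk] at h1
    rw [hwj] at h2
    have h3 : 1 / ((j : ℚ) + 1) = 1 / ((k : ℚ) + 1) := by
      rw [hkn]
      exact le_antisymm h1 h2
    rw [one_div, one_div, inv_inj, add_left_inj, Nat.cast_inj] at h3
    rwa [← Fin.ext h3]
  · intro hx
    exact ⟨k, hx, by rw [hwk, hkn], fun j hj => by rw [hkn]; exact hmin j hj⟩

theorem electionAlgorithm_exactlyElectsLeader (hG : G.Connected) (hN : Fintype.card V ≤ N) :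
    (electionAlgorithm N).ExactlyElectsLeader σ := by
  refine ⟨fun v => @decide_eq_true _ (Classical.dec _) (Or.inl rfl), ?_⟩
  refine successProb_eq_one (electionAlgorithm_isUnitary N) σ fun c hc => ?_
  obtain ⟨Φ, hΦ, hzero⟩ := networkState_final (σ := σ) hG hN
  have hc' : encode (fun X => averagingConfig σ X (2 * N + 1)) Φ c ≠ 0 := by
    rw [← hΦ]
    exact hc
  obtain ⟨X, -, hX⟩ := Finset.exists_ne_zero_of_sum_ne_zero hc'
  obtain ⟨hcX, hΦX⟩ : c = averagingConfig σ X (2 * N + 1) ∧ Φ X ≠ 0 := by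
    by_cases h : c = averagingConfig σ X (2 * N + 1)
    · exact ⟨h, by simpa [h] using hX⟩
    · simp [h] at hX
  have : Nonempty V := hG.nonempty
  have hn : 0 < Fintype.card V := Fintype.card_pos
  let k : Fin N := ⟨Fintype.card V - 1, by omega⟩
  have hk : (k : ℕ) + 1 = Fintype.card V := Nat.sub_add_cancel hn
  have hweight : weight (fun u => X u k) = 1 := by
    by_contra h
    exact hΦX (hzero X k hk h)
  have hout : ∀ v, (electionAlgorithm N).output (G.degree v) (c v).1 = true ↔ X v k = true := by
    intro v
    have h1 : (c v).1 = finalMemory σ X v := by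
      rw [hcX]
      exact averagingConfig_final σ X hN v
    rw [h1]
    refine (@decide_eq_true_iff _ (Classical.dec _)).trans ?_
    rw [or_iff_right (by simp [finalMemory])]
    exact wins_iff hn (fun k => learnedRatios_finalMemory σ X hG hN v k) hk hweight _
  obtain ⟨v, hv⟩ := weight_eq_one.1 hweight
  have hXk : ∀ u, X u k = true ↔ u = v := by
    intro u
    rw [congrFun hv u, decide_eq_true_iff]
  exact ⟨v, (hout v).2 ((hXk v).2 rfl), fun u hu => (hXk u).1 ((hout u).1 hu)⟩

end Run
end AnonQNet

theorem mainTheorem8 :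
    ∃ (A : ℕ → AnonQNet.Algorithm) (C : ℕ),
      ∀ (N n : ℕ), n ≤ N →
      ∀ (G : SimpleGraph (Fin n)) [DecidableRel G.Adj], G.Connected →
      ∀ σ : AnonQNet.PortNumbering G,
        (A N).ExactlyElectsLeader σ ∧
        (A N).rounds ≤ C * N ∧
        (A N).bitComplexity σ ≤ C * (G.edgeFinset.card * N ^ 3) := by
  -- The constant is `16 * 2 * 4`: at most `16 * N` rounds, two directions on each link, and
  -- messages of length at most `4 * N ^ 2`.
  refine ⟨AnonQNet.electionAlgorithm, 128, fun N n hn G _ hG σ => ?_⟩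
  have hpos : 1 ≤ N := by
    obtain ⟨v⟩ := hG.nonempty
    have := v.2
    omega
  have hrounds : (AnonQNet.electionAlgorithm N).rounds ≤ 16 * N := by
    change 10 * N + 6 ≤ 16 * N
    omega
  refine ⟨AnonQNet.electionAlgorithm_exactlyElectsLeader hG (by simpa using hn),
    hrounds.trans (by omega), ?_⟩
  calc _ ≤ _ := AnonQNet.Algorithm.bitComplexity_le _ σ
    _ ≤ 16 * N * (2 * G.edgeFinset.card * (4 * N ^ 2)) := Nat.mul_le_mul_right _ hrounds
    _ = 128 * (G.edgeFinset.card * N ^ 3) := by ring
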